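/- \textbf{Setting.} Fix $L,g,\delta,\rho>0$ and $\alpha\in(0,1)$. Let $\gamma\in C^{1+\alpha}([0,\infty))$ (finite Hölder norm) with $\gamma(r)=O(r^{-2-2\rho})$ as $r\to\infty$. Put $\Gamma(p)=\int_0^p\gamma(-p')\,dp'$ for $p\le 0$, $\Gamma_{\inf}=\inf_{p\le 0}\Gamma(p)$, $a(p;\lambda)=(\lambda+2\Gamma(p))^{1/2}$, $R=(-L,L)\times(-\infty,0)$, $T=(-L,L)\times\{0\}$, with points written $(q,p)$. Let $C^{3+\alpha}_{per}(\overline R)$ be the space of functions that are even and $2L$-periodic in $q$, of class $C^{3}$ on $\mathbb R\times(-\infty,0]$, with finite norm $$\|w\|_X=\sum_{k_1+k_2\le 3}\sup_{\overline R}|\partial_p^{k_2}\partial_q^{k_1}w|+\sup_{k_1+k_2=3}\ \sup_{z\ne z'\in\overline R}\frac{|\partial_p^{k_2}\partial_q^{k_1}w(z)-\partial_p^{k_2}\partial_q^{k_1}w(z')|}{|z-z'|^{\alpha}} .$$ Let $X$ be the set of $w\in C^{3+\alpha}_{per}(\overline R)$ such that $\partial_p^{k_2}\partial_q^{k_1}w\to0$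 as $p\to-\infty$, uniformly in $q$, for all $k_1+k_2\le 3$. Let $X'\supseteq X$ be the set defined in the same way, but with this requirement only for $1\le k_1+k_2\le 3$. Let $$F_1(\lambda,w)=(1+w_q^2)w_{pp}-2(a^{-1}+w_p)w_qw_{pq}+(a^{-1}+w_p)^2w_{qq}+\gamma(-p)(a^{-1}+w_p)^3-\gamma(-p)a^{-3}(1+w_q^2)\ \text{ in }R,$$ $$F_2(\lambda,w)=1+(2gw-\lambda)(\lambda^{-1/2}+w_p)^2+w_q^2\ \text{ on }T,$$ where $a=a(p;\lambda)$. For $\mathcal X\in\{X,X'\}$ let $\mathcal O_\delta(\mathcal X)$ be the set of $(\lambda,w)\in\mathbb R\times\mathcal X$ with $\lambda>-2\Gamma_{\inf}+\delta$, $a^{-1}(p;\lambda)+w_p>\delta$ in $R$, and $w<\frac{2\lambda-\delta}{4g}$ on $T$. Let $\mathcal N$ be the set of $w$ with $$w_q>0 \text{ on }(-L,0)\times(-\infty,0],\qquad w_{qq}(-L,p)>0 \text{ and } w_{qq}(0,p)<0\ \text{ for all } p\le 0 .$$ Let $\mathcal S_\delta(\mathcal X)$ be the set of all $(\lambda,w)\in\mathcal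 O_\delta(\mathcal X)$ with $F_1(\lambda,w)=0$ in $R$, $F_2(\lambda,w)=0$ on $T$, $w\not\equiv0$, $w\in\mathcal N$ and $w_q=O(|p|^{-1-\rho})$ as $p\to-\infty$ (uniformly in $q$), together with the point $(\lambda^0,0)$ if it exists, where $\lambda^0\in(-2\Gamma_{\inf},gL/\pi-2\Gamma_{\inf}]$ is the solution of $$\inf_{0\neq v\in H^1((-\infty,0))}\frac{-gv(0)^2+\int_{-\infty}^0a^3(p;\lambda)\,v'(p)^2\,dp}{\int_{-\infty}^0a(p;\lambda)\,v(p)^2\,dp}=-\Big(\frac{\pi}{L}\Big)^2 .$$ \textbf{Lemma (Exponential decay).} There is a constant $K>0$ (depending only on the data $\gamma,\alpha,\rho,L,g,\delta$ fixed above) such that for every $M>0$ and every $\beta>\frac{KM^2}{2\delta^2}$ the following holds. All sufficiently small $\sigma>0$ satisfy $$2\sigma^2(1+M^2)+4\beta\sigma KM^2-\tfrac12e^{-\beta L}KM^2<0, \qquad (*)$$ and for every $\sigma>0$ satisfying $(*)$ and every $(\lambda,w)\in\mathcal S_\delta(X)\cup\mathcal S_\delta(X')$ with $|\lambda|+\|w\|_X<M$,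 $$|w_q(q,p)|\le M\,(2-e^{-\beta|q|})\,e^{\sigma p}\qquad\text{for all }(q,p)\in R .$$ -/

import Mathlib

open Set Filter Topology MeasureTheory Asymptotics
open scoped ENNReal

noncomputable section

namespace DeepStokes

/-! ### The vorticity function and the trivial flow -/

/-- `γ ∈ C^{1+α}([0,∞))`: continuously differentiable on `[0,∞)` with finite Hölder norm.
Only the values of `γ` on `[0,∞)` are used anywhere. -/
def VorticityHolder (α : ℝ) (γ : ℝ → ℝ) : Prop :=
  ContDiffOn ℝ 1 γ (Ici 0) ∧
    ∃ C : ℝ, (∀ r ∈ Ici (0 : ℝ), |γ r| ≤ C ∧ |derivWithin γ (Ici 0) r| ≤ C) ∧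
      ∀ r ∈ Ici (0 : ℝ), ∀ s ∈ Ici (0 : ℝ),
        |derivWithin γ (Ici 0) r - derivWithin γ (Ici 0) s| ≤ C * |r - s| ^ α

/-- `Γ(p) = ∫₀^p γ(-p') dp'`, for `p ≤ 0`. -/
def Gam (γ : ℝ → ℝ) (p : ℝ) : ℝ := ∫ s in (0 : ℝ)..p, γ (-s)

/-- `Γ_inf = inf_{p ≤ 0} Γ(p)`. -/
def GamInf (γ : ℝ → ℝ) : ℝ := sInf (Gam γ '' Iic 0)

/-- `a(p; lam) = (lam + 2 Γ(p))^{1/2}`. -/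
def a (γ : ℝ → ℝ) (lam p : ℝ) : ℝ := Real.sqrt (lam + 2 * Gam γ p)

/-! ### Domains and derivatives; a point `z` is `(q, p)` -/

/-- The closed lower half-plane, on which functions that are periodic in `q` are defined. -/
def halfPlane : Set (ℝ × ℝ) := {z | z.2 ≤ 0}

/-- `R = (-L, L) × (-∞, 0)`. -/
def R (L : ℝ) : Set (ℝ × ℝ) := Ioo (-L) L ×ˢ Iio 0

/-- The closure `[-L, L] × (-∞, 0]` of `R`. -/
def Rbar (L : ℝ) : Set (ℝ × ℝ) := Icc (-L) L ×ˢ Iic 0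

/-- `T = (-L, L) × {0}`. -/
def T (L : ℝ) : Set (ℝ × ℝ) := Ioo (-L) L ×ˢ {0}

/-- Partial derivative in `q` on the closed half-plane. -/
def dq (f : ℝ × ℝ → ℝ) (z : ℝ × ℝ) : ℝ := fderivWithin ℝ f halfPlane z (1, 0)

/-- Partial derivative in `p` on the closed half-plane (one-sided at `p = 0`). -/
def dp (f : ℝ × ℝ → ℝ) (z : ℝ × ℝ) : ℝ := fderivWithin ℝ f halfPlane z (0, 1)

/-- `∂_p^{k₂} ∂_q^{k₁} f`. -/
def pd (k₁ k₂ : ℕ) (f : ℝ × ℝ → ℝ) : ℝ × ℝ → ℝ := dp^[k₂] (dq^[k₁] f)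

/-! ### The Hölder norm and the space `X` -/

/-- The `C^{k+α}` Hölder norm over the closure of `R`, with values in `[0,∞]`. -/
def holderENorm (k : ℕ) (α L : ℝ) (f : ℝ × ℝ → ℝ) : ℝ≥0∞ :=
  (∑ n ∈ Finset.range (k + 1), ∑ i ∈ Finset.HasAntidiagonal.antidiagonal n,
      ⨆ z ∈ Rbar L, ENNReal.ofReal |pd i.1 i.2 f z|) +
    ⨆ i ∈ Finset.HasAntidiagonal.antidiagonal k, ⨆ z ∈ Rbar L, ⨆ z' ∈ Rbar L, ⨆ _ : z ≠ z',
      ENNReal.ofReal (|pd i.1 i.2 f z - pd i.1 i.2 f z'| /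
        ((z.1 - z'.1) ^ 2 + (z.2 - z'.2) ^ 2) ^ (α / 2))

/-- `w ∈ C^{3+α}_per`: a `C^{3+α}` function on the closure of `R` with finite Hölder norm, even and
`2L`-periodic in `q`; being periodic, it is given on `halfPlane`, and its values elsewhere do not
matter. -/
structure MemHolderPer (α L : ℝ) (w : ℝ × ℝ → ℝ) : Prop where
  contDiffOn : ContDiffOn ℝ 3 w halfPlane
  even : ∀ q p : ℝ, p ≤ 0 → w (-q, p) = w (q, p)
  periodic : ∀ q p : ℝ, p ≤ 0 → w (q + 2 * L, p) = w (q, p)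
  norm_lt_top : holderENorm 3 α L w < ⊤

/-- `f = o(1)` as `p → -∞`, uniformly for `q`. -/
def VanishesBelow (L : ℝ) (f : ℝ × ℝ → ℝ) : Prop :=
  ∀ ε > 0, ∃ P : ℝ, ∀ z ∈ Rbar L, z.2 ≤ P → |f z| < ε

/-- The space `X`: functions in `C^{3+α}_per` all of whose derivatives up to order three, the
function itself included, vanish as `p → -∞`, uniformly for `q`. -/
def X (α L : ℝ) : Set (ℝ × ℝ → ℝ) :=
  {w | MemHolderPer α L w ∧ ∀ k₁ k₂ : ℕ, k₁ + k₂ ≤ 3 → VanishesBelow L (pd k₁ k₂ w)}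

/-- The larger space in which only the derivatives of orders one to three are required to vanish
as `p → -∞`; the function itself is merely bounded. -/
def Xgrad (α L : ℝ) : Set (ℝ × ℝ → ℝ) :=
  {w | MemHolderPer α L w ∧
    ∀ k₁ k₂ : ℕ, 1 ≤ k₁ + k₂ → k₁ + k₂ ≤ 3 → VanishesBelow L (pd k₁ k₂ w)}

/-- `‖w‖_X`, a real number for `w` in `C^{3+α}_per`. -/
def normX (α L : ℝ) (w : ℝ × ℝ → ℝ) : ℝ := (holderENorm 3 α L w).toReal

/-! ### The operator `F = (F₁, F₂)` and the set `𝒪_δ` -/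

def F₁ (γ : ℝ → ℝ) (lam : ℝ) (w : ℝ × ℝ → ℝ) (z : ℝ × ℝ) : ℝ :=
  (1 + dq w z ^ 2) * dp (dp w) z
    - 2 * ((a γ lam z.2)⁻¹ + dp w z) * dq w z * dp (dq w) z
    + ((a γ lam z.2)⁻¹ + dp w z) ^ 2 * dq (dq w) z
    + γ (-z.2) * ((a γ lam z.2)⁻¹ + dp w z) ^ 3
    - γ (-z.2) * (a γ lam z.2)⁻¹ ^ 3 * (1 + dq w z ^ 2)

def F₂ (g lam : ℝ) (w : ℝ × ℝ → ℝ) (z : ℝ × ℝ) : ℝ :=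
  1 + (2 * g * w z - lam) * ((Real.sqrt lam)⁻¹ + dp w z) ^ 2 + dq w z ^ 2

/-- `F(lam, w) = 0`. -/
def IsSolution (γ : ℝ → ℝ) (L g lam : ℝ) (w : ℝ × ℝ → ℝ) : Prop :=
  (∀ z ∈ R L, F₁ γ lam w z = 0) ∧ (∀ z ∈ T L, F₂ g lam w z = 0)

/-- The set `𝒪_δ ⊆ ℝ × 𝒳`, for a space `𝒳` of functions. -/
def O (𝒳 : Set (ℝ × ℝ → ℝ)) (γ : ℝ → ℝ) (L g δ : ℝ) : Set (ℝ × (ℝ × ℝ → ℝ)) :=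
  {x | x.2 ∈ 𝒳 ∧ -2 * GamInf γ + δ < x.1 ∧
    (∀ z ∈ R L, δ < (a γ x.1 z.2)⁻¹ + dp x.2 z) ∧
    (∀ z ∈ T L, x.2 z < (2 * x.1 - δ) / (4 * g))}

/-! ### The nodal set `𝒩` -/

/-- The nodal properties: `w_q > 0` on `(-L,0) × (-∞,0]`, and the signs of `w_qq` on the two
vertical half-lines `q = -L`, `q = 0`, corners included. -/
structure Nodal (L : ℝ) (w : ℝ × ℝ → ℝ) : Prop where
  dq_pos : ∀ q ∈ Ioo (-L) 0, ∀ p ≤ (0 : ℝ), 0 < dq w (q, p)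
  left : ∀ p < (0 : ℝ), 0 < dq (dq w) (-L, p)
  right : ∀ p < (0 : ℝ), dq (dq w) (0, p) < 0
  left_corner : 0 < dq (dq w) (-L, 0)
  right_corner : dq (dq w) (0, 0) < 0

/-! ### The bifurcation point -/

/-- `v ∈ H¹((-∞,0))` with weak derivative `v'`; `v` is the absolutely continuous representative,
extended continuously to `p = 0`. -/
def IsH1 (v v' : ℝ → ℝ) : Prop :=
  MemLp v 2 (volume.restrict (Iio 0)) ∧ MemLp v' 2 (volume.restrict (Iio 0)) ∧
    ∀ p ≤ (0 : ℝ), v p = v 0 - ∫ s in p..(0 : ℝ), v' s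

/-- The values of the Rayleigh quotient over nonzero `v ∈ H¹((-∞,0))`. -/
def rayleighValues (γ : ℝ → ℝ) (g lam : ℝ) : Set ℝ :=
  {r | ∃ v v' : ℝ → ℝ, IsH1 v v' ∧ (∃ p ≤ (0 : ℝ), v p ≠ 0) ∧
    r = (-g * v 0 ^ 2 + ∫ p in Iio (0 : ℝ), a γ lam p ^ 3 * v' p ^ 2) /
      ∫ p in Iio (0 : ℝ), a γ lam p * v p ^ 2}

/-- `lam` is the bifurcation value: the infimum of the Rayleigh quotient is `-(π/L)²`. -/
def IsBifurcationValue (γ : ℝ → ℝ) (L g lam : ℝ) : Prop :=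
  lam ∈ Ioc (-2 * GamInf γ) (g * L / Real.pi - 2 * GamInf γ) ∧
    IsGLB (rayleighValues γ g lam) (-(Real.pi / L) ^ 2)

/-! ### The solution set `𝒮_δ` -/

/-- `𝒮_δ ⊆ ℝ × 𝒳`: the nontrivial solutions in `𝒪_δ` with the nodal properties and with
`w_q = O(|p|^{-1-ρ})` as `p → -∞`, together with the bifurcation point `(λ⁰, 0)`. -/
def S (𝒳 : Set (ℝ × ℝ → ℝ)) (γ : ℝ → ℝ) (ρ L g δ : ℝ) : Set (ℝ × (ℝ × ℝ → ℝ)) :=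
  {x | x ∈ O 𝒳 γ L g δ ∧ IsSolution γ L g x.1 x.2 ∧ (∃ z ∈ halfPlane, x.2 z ≠ 0) ∧
      Nodal L x.2 ∧
      ∃ C P : ℝ, P < 0 ∧ ∀ z ∈ Rbar L, z.2 ≤ P → |dq x.2 z| ≤ C * |z.2| ^ (-1 - ρ)} ∪
    {x | IsBifurcationValue γ L g x.1 ∧ ∀ z ∈ halfPlane, x.2 z = 0}

end DeepStokes

end

/-!
The function `v = w_q` satisfies a linear equation without zeroth-order term (`linearized_eq`),
`(1 + w_q²) v_pp - 2 b w_q v_pq + b² v_qq + D v_q + E v_p = 0`, where `b = a⁻¹ + w_p > δ` and `D`,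
`E` are bounded. It results from differentiating `F₁ = 0` in `q`; since `a` and `γ` depend on `p`
alone, neither needs to be differentiated.

By evenness and the sign of `w_q` it suffices to bound `w_q` from above on the left half
`(-L, 0) × (-∞, 0)` of `R`. There it is compared with the barrier `φ = M (2 - e^{βq}) e^{σp}`.
Evenness and periodicity give `w_q = 0 ≤ φ` on the vertical sides, the bound `‖w‖_X < M` gives
`w_q ≤ M ≤ φ` at the top, and `w_q → 0` at the bottom, so a positive value of `w_q - φ` would force
a positive interior maximum. The principal part of the equation at `u = w_q - φ` is the sum of the
second derivatives of `u` in the directions `(0, 1)` and `(b, -w_q)`, hence it is nonpositive at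
such a maximum, while the gradient of `u` vanishes (`barrier_conditions`). This contradicts `φ` being
a strict supersolution (`dq_le_barrier`).

That `φ` is a strict supersolution (`supersolution_ineq`) comes from the term `-b² β² e^{βq}`, which
dominates as `β > K M² / (2δ²)`. The constant `K` is chosen so that all coefficients are bounded by
multiples of `K M²` (`coeff_bounds`). This is possible because a solution in `𝒪_δ` has `λ > δ`, as
`Γ_inf ≤ 0`, so that `M > δ`. The decay of `γ` enters only through the boundedness of `Γ` from
below, which makes `Γ_inf` a true infimum and yields `a⁻¹ ≤ δ^{-1/2}`.
-/

namespace DeepStokes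

/-! ### Second-order test and calculus for `dq` and `dp` -/

/-- Second-order necessary condition at a local maximum: otherwise the second-derivative test would
make the point a local minimum too, so that the function would be locally constant. -/
lemma second_deriv_nonpos_of_isLocalMax {f f' : ℝ → ℝ} {f'' x : ℝ}
    (hf : ∀ᶠ t in 𝓝 x, HasDerivAt f (f' t) t) (hf' : HasDerivAt f' f'' x)
    (hmax : IsLocalMax f x) : f'' ≤ 0 := by
  by_contra! hpos
  have hd : deriv f =ᶠ[𝓝 x] f' := hf.mono fun t ht => ht.deriv
  have hdd : deriv (deriv f) x = f'' := by rw [hd.deriv_eq, hf'.deriv]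
  have hmin : IsLocalMin f x := isLocalMin_of_deriv_deriv_pos (by rw [hdd]; exact hpos)
    hmax.deriv_eq_zero hf.self_of_nhds.continuousAt
  have hconst : f =ᶠ[𝓝 x] fun _ => f x := by
    filter_upwards [hmax, hmin] with t h1 h2 using le_antisymm h1 h2
  have h0 : deriv (deriv f) x = 0 := by
    rw [hconst.deriv.deriv_eq]; simp
  linarith

lemma halfPlane_mem_nhds {z : ℝ × ℝ} (hz : z.2 < 0) : halfPlane ∈ 𝓝 z :=
  mem_of_superset ((isOpen_Iio.preimage continuous_snd).mem_nhds hz) fun y (h : y.2 < 0) => h.le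

lemma eventually_snd_neg {z : ℝ × ℝ} (hz : z.2 < 0) : ∀ᶠ y in 𝓝 z, y.2 < 0 :=
  (isOpen_Iio.preimage continuous_snd).mem_nhds hz

lemma dq_eq_fderiv (f : ℝ × ℝ → ℝ) {z : ℝ × ℝ} (hz : z.2 < 0) : dq f z = fderiv ℝ f z (1, 0) := by
  rw [dq, fderivWithin_of_mem_nhds (halfPlane_mem_nhds hz)]

lemma dp_eq_fderiv (f : ℝ × ℝ → ℝ) {z : ℝ × ℝ} (hz : z.2 < 0) : dp f z = fderiv ℝ f z (0, 1) := by
  rw [dp, fderivWithin_of_mem_nhds (halfPlane_mem_nhds hz)]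

lemma dq_eventuallyEq (f : ℝ × ℝ → ℝ) {z : ℝ × ℝ} (hz : z.2 < 0) :
    dq f =ᶠ[𝓝 z] fun y => fderiv ℝ f y (1, 0) :=
  (eventually_snd_neg hz).mono fun _ hy => dq_eq_fderiv f hy

lemma dp_eventuallyEq (f : ℝ × ℝ → ℝ) {z : ℝ × ℝ} (hz : z.2 < 0) :
    dp f =ᶠ[𝓝 z] fun y => fderiv ℝ f y (0, 1) :=
  (eventually_snd_neg hz).mono fun _ hy => dp_eq_fderiv f hy

lemma contDiffAt_dq {f : ℝ × ℝ → ℝ} {z : ℝ × ℝ} {n m : ℕ∞} (hz : z.2 < 0)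
    (hf : ContDiffAt ℝ n f z) (hnm : m + 1 ≤ n) : ContDiffAt ℝ m (dq f) z :=
  ((hf.fderiv_right (by exact_mod_cast hnm)).clm_apply contDiffAt_const).congr_of_eventuallyEq
    (dq_eventuallyEq f hz)

lemma contDiffAt_dp {f : ℝ × ℝ → ℝ} {z : ℝ × ℝ} {n m : ℕ∞} (hz : z.2 < 0)
    (hf : ContDiffAt ℝ n f z) (hnm : m + 1 ≤ n) : ContDiffAt ℝ m (dp f) z :=
  ((hf.fderiv_right (by exact_mod_cast hnm)).clm_apply contDiffAt_const).congr_of_eventuallyEq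
    (dp_eventuallyEq f hz)

lemma hasDerivAt_line {f : ℝ × ℝ → ℝ} {z d : ℝ × ℝ} {t : ℝ} (hz : (z + t • d).2 < 0)
    (hf : DifferentiableAt ℝ f (z + t • d)) :
    HasDerivAt (fun s : ℝ => f (z + s • d))
      (d.1 * dq f (z + t • d) + d.2 * dp f (z + t • d)) t := by
  have hline : HasDerivAt (fun s : ℝ => z + s • d) d t := by
    simpa using ((hasDerivAt_id t).smul_const d).const_add z
  have h := hf.hasFDerivAt.comp_hasDerivAt t hline
  refine h.congr_deriv ?_
  rw [dq_eq_fderiv f hz, dp_eq_fderiv f hz]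
  have hd : d = d.1 • ((1 : ℝ), (0 : ℝ)) + d.2 • ((0 : ℝ), (1 : ℝ)) := by ext <;> simp
  conv_lhs => rw [hd, map_add, map_smul, map_smul]
  simp

lemma hasDerivAt_line_zero {f : ℝ × ℝ → ℝ} {z d : ℝ × ℝ} (hz : z.2 < 0)
    (hf : DifferentiableAt ℝ f z) :
    HasDerivAt (fun s : ℝ => f (z + s • d)) (d.1 * dq f z + d.2 * dp f z) 0 := by
  have hz' : z + (0 : ℝ) • d = z := by simp
  have := hasDerivAt_line (f := f) (z := z) (d := d) (t := 0) (by rwa [hz']) (by rwa [hz'])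
  rwa [hz'] at this

lemma hasDerivAt_horizontal {f : ℝ × ℝ → ℝ} {z : ℝ × ℝ} (hz : z.2 < 0)
    (hf : DifferentiableAt ℝ f z) :
    HasDerivAt (fun s : ℝ => f (z + s • (1, 0))) (dq f z) 0 := by
  simpa using hasDerivAt_line_zero (d := (1, 0)) hz hf

lemma dp_congr {f g : ℝ × ℝ → ℝ} {z : ℝ × ℝ} (hz : z.2 < 0) (h : f =ᶠ[𝓝 z] g) :
    dp f z = dp g z := by
  rw [dp_eq_fderiv f hz, dp_eq_fderiv g hz, h.fderiv_eq]

lemma dq_dp_comm {f : ℝ × ℝ → ℝ} {z : ℝ × ℝ} (hz : z.2 < 0) (hf : ContDiffAt ℝ 2 f z) :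
    dq (dp f) z = dp (dq f) z := by
  have hsymm : IsSymmSndFDerivAt ℝ f z := hf.isSymmSndFDerivAt (by simp)
  have hd : DifferentiableAt ℝ (fderiv ℝ f) z :=
    (hf.fderiv_right (m := 1) (by norm_num)).differentiableAt (by norm_num)
  rw [dq_eq_fderiv _ hz, dp_eq_fderiv _ hz, (dp_eventuallyEq f hz).fderiv_eq,
    (dq_eventuallyEq f hz).fderiv_eq, fderiv_clm_apply hd (differentiableAt_const _),
    fderiv_clm_apply hd (differentiableAt_const _)]
  simpa using hsymm (1, 0) (0, 1)

/-! ### The differential equation satisfied by `w_q` -/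

/-- The factor `a⁻¹ + w_p`, which is bounded below by `δ` on `𝒪_δ`. -/
noncomputable def slope (γ : ℝ → ℝ) (lam : ℝ) (w : ℝ × ℝ → ℝ) (z : ℝ × ℝ) : ℝ :=
  (a γ lam z.2)⁻¹ + dp w z

/-- The coefficient of `∂_q w_q` in the equation for `w_q`. -/
noncomputable def driftQ (γ : ℝ → ℝ) (lam : ℝ) (w : ℝ × ℝ → ℝ) (z : ℝ × ℝ) : ℝ :=
  2 * dq w z * dp (dp w) z - 2 * slope γ lam w z * dp (dq w) z
    - 2 * γ (-z.2) * (a γ lam z.2)⁻¹ ^ 3 * dq w z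

/-- The coefficient of `∂_p w_q` in the equation for `w_q`. -/
noncomputable def driftP (γ : ℝ → ℝ) (lam : ℝ) (w : ℝ × ℝ → ℝ) (z : ℝ × ℝ) : ℝ :=
  -2 * dq w z * dp (dq w) z + 2 * slope γ lam w z * dq (dq w) z
    + 3 * γ (-z.2) * slope γ lam w z ^ 2

/-- The equation for `v = w_q`, obtained by differentiating `F₁ = 0` along horizontal lines, on
which `a` and `γ` are constant. It is linear in the derivatives of `v` and has no term of order
zero. -/
lemma linearized_eq {γ : ℝ → ℝ} {lam L : ℝ} {w : ℝ × ℝ → ℝ} (hw : ContDiffOn ℝ 3 w halfPlane)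
    (hF : ∀ z ∈ R L, F₁ γ lam w z = 0) {z : ℝ × ℝ} (hz : z ∈ R L) :
    (1 + dq w z ^ 2) * dp (dp (dq w)) z
      - 2 * slope γ lam w z * dq w z * dp (dq (dq w)) z
      + slope γ lam w z ^ 2 * dq (dq (dq w)) z
      + driftQ γ lam w z * dq (dq w) z + driftP γ lam w z * dp (dq w) z = 0 := by
  have hz2 : z.2 < 0 := hz.2
  have hwz : ∀ y : ℝ × ℝ, y.2 < 0 → ContDiffAt ℝ 3 w y := fun y hy =>
    hw.contDiffAt (halfPlane_mem_nhds hy)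
  have h2q : ∀ y : ℝ × ℝ, y.2 < 0 → ContDiffAt ℝ 2 (dq w) y := fun y hy =>
    contDiffAt_dq (n := 3) (m := 2) hy (hwz y hy) (by norm_num)
  have h2p : ∀ y : ℝ × ℝ, y.2 < 0 → ContDiffAt ℝ 2 (dp w) y := fun y hy =>
    contDiffAt_dp (n := 3) (m := 2) hy (hwz y hy) (by norm_num)
  have h1 : ∀ {f : ℝ × ℝ → ℝ}, ContDiffAt ℝ 1 f z → DifferentiableAt ℝ f z := fun h =>
    h.differentiableAt (by norm_num)
  have e1 : dq (dp w) z = dp (dq w) z := dq_dp_comm hz2 ((hwz z hz2).of_le (by norm_num))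
  have e2 : dq (dp (dp w)) z = dp (dp (dq w)) z := by
    rw [dq_dp_comm hz2 (h2p z hz2)]
    exact dp_congr hz2 ((eventually_snd_neg hz2).mono fun y hy =>
      dq_dp_comm hy ((hwz y hy).of_le (by norm_num)))
  have e3 : dq (dp (dq w)) z = dp (dq (dq w)) z := dq_dp_comm hz2 (h2q z hz2)
  have dQ := hasDerivAt_horizontal hz2 (h1 ((h2q z hz2).of_le (by norm_num)))
  have dP := hasDerivAt_horizontal hz2 (h1 ((h2p z hz2).of_le (by norm_num)))
  have dPP := hasDerivAt_horizontal hz2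
    (h1 (contDiffAt_dp (n := 2) (m := 1) hz2 (h2p z hz2) (by norm_num)))
  have dPQ := hasDerivAt_horizontal hz2
    (h1 (contDiffAt_dp (n := 2) (m := 1) hz2 (h2q z hz2) (by norm_num)))
  have dQQ := hasDerivAt_horizontal hz2
    (h1 (contDiffAt_dq (n := 2) (m := 1) hz2 (h2q z hz2) (by norm_num)))
  rw [e1] at dP
  rw [e2] at dPP
  rw [e3] at dPQ
  have dB := dP.const_add (a γ lam z.2)⁻¹
  have dF := ((((((dQ.pow 2).const_add 1).mul dPP).sub
    (((dB.const_mul 2).mul dQ).mul dPQ)).add ((dB.pow 2).mul dQQ)).add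
    ((dB.pow 3).const_mul (γ (-z.2)))).sub
    (((dQ.pow 2).const_add 1).const_mul (γ (-z.2) * (a γ lam z.2)⁻¹ ^ 3))
  have hcont : Tendsto (fun t : ℝ => z + t • ((1 : ℝ), (0 : ℝ))) (𝓝 0) (𝓝 z) := by
    have : Continuous fun t : ℝ => z + t • ((1 : ℝ), (0 : ℝ)) := by fun_prop
    simpa using this.tendsto 0
  have hR : R L ∈ 𝓝 z := (isOpen_Ioo.prod isOpen_Iio).mem_nhds hz
  have hzero := (hasDerivAt_const (0 : ℝ) (0 : ℝ)).congr_of_eventuallyEq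
    (f₁ := fun t : ℝ => F₁ γ lam w (z + t • ((1 : ℝ), (0 : ℝ))))
    ((hcont.eventually hR).mono fun t ht => hF _ ht)
  have hF' := dF.congr_of_eventuallyEq
    (f₁ := fun t : ℝ => F₁ γ lam w (z + t • ((1 : ℝ), (0 : ℝ))))
    (Eventually.of_forall fun t => by simp [F₁])
  have key := hF'.unique hzero
  have hz0 : z + ((0 : ℝ), (0 : ℝ)) = z := by ext <;> simp
  simp [hz0] at key
  simp only [driftQ, driftP, slope]
  linear_combination key

/-! ### Bounds on the coefficients -/

lemma VorticityHolder.integrableOn {α ρ : ℝ} {γ : ℝ → ℝ} (hρ : 0 < ρ) (hγ : VorticityHolder α γ)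
    (hdecay : γ =O[atTop] fun r : ℝ => r ^ (-2 - 2 * ρ)) : IntegrableOn γ (Ici 0) :=
  LocallyIntegrableOn.integrableOn_of_isBigO_atTop
    (hγ.1.continuousOn.locallyIntegrableOn measurableSet_Ici) hdecay
    ⟨Ioi 1, Ioi_mem_atTop 1, integrableOn_Ioi_rpow_of_lt (by linarith) one_pos⟩

lemma bddBelow_Gam {γ : ℝ → ℝ} (hγ : IntegrableOn γ (Ici 0)) : BddBelow (Gam γ '' Iic 0) := by
  refine ⟨-∫ r in Ici (0 : ℝ), |γ r|, ?_⟩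
  rintro _ ⟨p, hp, rfl⟩
  have hp : p ≤ 0 := hp
  have h1 : Gam γ p = -∫ r in (0 : ℝ)..(-p), γ r := by
    rw [Gam, intervalIntegral.integral_comp_neg, intervalIntegral.integral_symm, neg_zero]
  have h2 : |∫ r in (0 : ℝ)..(-p), γ r| ≤ ∫ r in Ici (0 : ℝ), |γ r| := by
    rw [intervalIntegral.integral_of_le (by linarith)]
    refine (abs_integral_le_integral_abs).trans ?_
    exact setIntegral_mono_set hγ.abs (Eventually.of_forall fun _ => abs_nonneg _)
      (LE.le.eventuallyLE fun r hr => hr.1.le)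
  rw [h1]
  linarith [le_abs_self (∫ r in (0 : ℝ)..(-p), γ r)]

lemma GamInf_nonpos {γ : ℝ → ℝ} (h : BddBelow (Gam γ '' Iic 0)) : GamInf γ ≤ 0 := by
  have h0 : Gam γ 0 = 0 := by simp [Gam]
  exact h0 ▸ csInf_le h ⟨0, self_mem_Iic, rfl⟩

lemma a_inv_bounds {γ : ℝ → ℝ} {lam δ p : ℝ} (hδ : 0 < δ) (h : BddBelow (Gam γ '' Iic 0))
    (hlam : -2 * GamInf γ + δ < lam) (hp : p ≤ 0) :
    0 ≤ (a γ lam p)⁻¹ ∧ (a γ lam p)⁻¹ ≤ (Real.sqrt δ)⁻¹ := by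
  have h1 : GamInf γ ≤ Gam γ p := csInf_le h ⟨p, hp, rfl⟩
  refine ⟨inv_nonneg.2 (Real.sqrt_nonneg _), ?_⟩
  exact inv_anti₀ (Real.sqrt_pos.2 hδ) (Real.sqrt_le_sqrt (by linarith))

lemma abs_pd_le_normX {α L : ℝ} {w : ℝ × ℝ → ℝ} (hw : MemHolderPer α L w) {k₁ k₂ : ℕ}
    (hk : k₁ + k₂ ≤ 3) {z : ℝ × ℝ} (hz : z ∈ Rbar L) : |pd k₁ k₂ w z| ≤ normX α L w := by
  have h1 : ENNReal.ofReal |pd k₁ k₂ w z| ≤ holderENorm 3 α L w := by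
    refine le_trans ?_ le_self_add
    refine le_trans ?_ (Finset.single_le_sum (f := fun n =>
      ∑ i ∈ Finset.HasAntidiagonal.antidiagonal n,
        ⨆ z ∈ Rbar L, ENNReal.ofReal |pd i.1 i.2 w z|) (fun _ _ => zero_le)
        (Finset.mem_range.2 (Nat.lt_succ_of_le hk)))
    refine le_trans ?_ (Finset.single_le_sum (f := fun i : ℕ × ℕ =>
        ⨆ z ∈ Rbar L, ENNReal.ofReal |pd i.1 i.2 w z|) (fun _ _ => zero_le)
        (a := (k₁, k₂)) (Finset.HasAntidiagonal.mem_antidiagonal.2 rfl))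
    exact le_iSup₂ (f := fun z (_ : z ∈ Rbar L) => ENNReal.ofReal |pd k₁ k₂ w z|) z hz
  exact (ENNReal.ofReal_le_iff_le_toReal hw.norm_lt_top.ne).1 h1

/-! ### Symmetry and regularity of `w_q` -/

lemma dq_eq_deriv {w : ℝ × ℝ → ℝ} {q p : ℝ} (hp : p < 0) (hw : DifferentiableAt ℝ w (q, p)) :
    dq w (q, p) = deriv (fun t => w (t, p)) q := by
  rw [dq_eq_fderiv w hp]
  have hline : HasDerivAt (fun t : ℝ => (t, p)) ((1 : ℝ), (0 : ℝ)) q :=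
    (hasDerivAt_id q).prodMk (hasDerivAt_const q p)
  exact (hw.hasFDerivAt.comp_hasDerivAt q hline).deriv.symm

lemma MemHolderPer.differentiableAt {α L : ℝ} {w : ℝ × ℝ → ℝ} (hw : MemHolderPer α L w)
    {z : ℝ × ℝ} (hz : z.2 < 0) : DifferentiableAt ℝ w z :=
  (hw.contDiffOn.contDiffAt (halfPlane_mem_nhds hz)).differentiableAt (by norm_num)

lemma MemHolderPer.dq_neg {α L : ℝ} {w : ℝ × ℝ → ℝ} (hw : MemHolderPer α L w) {q p : ℝ}
    (hp : p < 0) : dq w (-q, p) = -dq w (q, p) := by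
  rw [dq_eq_deriv hp (hw.differentiableAt hp), dq_eq_deriv hp (hw.differentiableAt hp)]
  have h := deriv_comp_neg (fun t => w (t, p)) q
  simp only [hw.even _ p hp.le] at h
  rw [h, neg_neg]

lemma MemHolderPer.dq_zero {α L : ℝ} {w : ℝ × ℝ → ℝ} (hw : MemHolderPer α L w) {p : ℝ}
    (hp : p < 0) : dq w (0, p) = 0 := by
  have := hw.dq_neg (q := 0) hp
  rw [neg_zero] at this
  linarith

lemma MemHolderPer.dq_left {α L : ℝ} {w : ℝ × ℝ → ℝ} (hw : MemHolderPer α L w) {p : ℝ}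
    (hp : p < 0) : dq w (-L, p) = 0 := by
  have h1 := hw.dq_neg (q := L) hp
  have h2 : dq w (-L, p) = dq w (L, p) := by
    rw [dq_eq_deriv hp (hw.differentiableAt hp), dq_eq_deriv hp (hw.differentiableAt hp)]
    have h := deriv_comp_add_const (fun t => w (t, p)) (2 * L) (-L)
    simp only [hw.periodic _ p hp.le] at h
    rw [h]
    ring_nf
  linarith

lemma uniqueDiffOn_halfPlane : UniqueDiffOn ℝ halfPlane := by
  have h : halfPlane = univ ×ˢ Iic (0 : ℝ) := by ext z; simp [halfPlane]
  rw [h]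
  exact uniqueDiffOn_univ.prod (uniqueDiffOn_Iic 0)

lemma continuousOn_dq {w : ℝ × ℝ → ℝ} (hw : ContDiffOn ℝ 3 w halfPlane) :
    ContinuousOn (dq w) halfPlane :=
  (hw.continuousOn_fderivWithin uniqueDiffOn_halfPlane (by norm_num)).clm_apply
    continuousOn_const

/-! ### The barrier and the maximum principle -/

/-- First and second order conditions, in an arbitrary direction `d`, at a local maximum of
`v - M (2 - e^{βq}) e^{σp}`. -/
lemma barrier_conditions {v : ℝ × ℝ → ℝ} {M β σ : ℝ} {z : ℝ × ℝ} (hz : z.2 < 0)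
    (hv : ∀ y : ℝ × ℝ, y.2 < 0 → ContDiffAt ℝ 2 v y)
    (hmax : IsLocalMax
      (fun y : ℝ × ℝ => v y - M * (2 - Real.exp (β * y.1)) * Real.exp (σ * y.2)) z) (d : ℝ × ℝ) :
    d.1 * dq v z + d.2 * dp v z - M * (-(β * d.1 * Real.exp (β * z.1))
        + (2 - Real.exp (β * z.1)) * (σ * d.2)) * Real.exp (σ * z.2) = 0 ∧
    d.1 ^ 2 * dq (dq v) z + 2 * d.1 * d.2 * dp (dq v) z + d.2 ^ 2 * dp (dp v) z
      - M * (-(β ^ 2 * d.1 ^ 2 * Real.exp (β * z.1))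
        - 2 * β * σ * d.1 * d.2 * Real.exp (β * z.1)
        + (2 - Real.exp (β * z.1)) * (σ ^ 2 * d.2 ^ 2)) * Real.exp (σ * z.2) ≤ 0 := by
  have hcont : Continuous fun t : ℝ => z + t • d := by fun_prop
  have htend : Tendsto (fun t : ℝ => z + t • d) (𝓝 0) (𝓝 z) := by
    simpa using hcont.tendsto 0
  have hneg : ∀ᶠ t : ℝ in 𝓝 0, (z + t • d).2 < 0 := htend.eventually (eventually_snd_neg hz)
  have hE : ∀ c x y t : ℝ, HasDerivAt (fun s : ℝ => Real.exp (c * (x + s * y)))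
      (Real.exp (c * (x + t * y)) * (c * y)) t := fun c x y t => by
    have h := ((((hasDerivAt_id t).mul_const y).const_add x).const_mul c).exp
    simpa using h
  have hf : ∀ᶠ t : ℝ in 𝓝 0, HasDerivAt
      (fun t : ℝ => v (z + t • d)
        - M * (2 - Real.exp (β * (z.1 + t * d.1))) * Real.exp (σ * (z.2 + t * d.2)))
      (d.1 * dq v (z + t • d) + d.2 * dp v (z + t • d)
        - M * (-(β * d.1 * Real.exp (β * (z.1 + t * d.1)))
          + (2 - Real.exp (β * (z.1 + t * d.1))) * (σ * d.2)) * Real.exp (σ * (z.2 + t * d.2)))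
      t := by
    filter_upwards [hneg] with t ht
    have h1 := hasDerivAt_line ht ((hv _ ht).differentiableAt (by norm_num))
    have h2 := (((hE β z.1 d.1 t).const_sub 2).const_mul M).mul (hE σ z.2 d.2 t)
    refine (h1.sub h2).congr_deriv ?_
    ring
  have hf' := (((hasDerivAt_line_zero (d := d) hz ((contDiffAt_dq (n := 2) (m := 1) hz (hv z hz)
        (by norm_num)).differentiableAt (by norm_num))).const_mul d.1).add
      ((hasDerivAt_line_zero (d := d) hz ((contDiffAt_dp (n := 2) (m := 1) hz (hv z hz)
        (by norm_num)).differentiableAt (by norm_num))).const_mul d.2)).sub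
    ((((hE β z.1 d.1 0).const_mul (β * d.1)).neg.add
      (((hE β z.1 d.1 0).const_sub 2).mul_const (σ * d.2))).const_mul M |>.mul (hE σ z.2 d.2 0))
  have hmax' : IsLocalMax (fun t : ℝ => v (z + t • d)
      - M * (2 - Real.exp (β * (z.1 + t * d.1))) * Real.exp (σ * (z.2 + t * d.2))) 0 := by
    filter_upwards [htend.eventually hmax] with t ht
    simpa using ht
  constructor
  · simpa using hmax'.hasDerivAt_eq_zero hf.self_of_nhds
  · have h := second_deriv_nonpos_of_isLocalMax hf hf' hmax'
    simp only [Pi.neg_apply, Pi.add_apply, zero_mul, add_zero] at h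
    rw [dq_dp_comm hz (hv z hz)] at h
    linarith

/-- The barrier `M (2 - e^{βq}) e^{σp}` dominates `w_q` on the left half of `R` as soon as it is a
strict supersolution of the equation for `w_q`. -/
lemma dq_le_barrier {α L lam M β σ : ℝ} {γ : ℝ → ℝ} {w : ℝ × ℝ → ℝ} (hw : MemHolderPer α L w)
    (hF : ∀ z ∈ R L, F₁ γ lam w z = 0) (hvan : VanishesBelow L (dq w)) (hM : 0 < M) (hβ : 0 < β)
    (hedge : ∀ z ∈ Rbar L, dq w z ≤ M)
    (hsuper : ∀ z ∈ R L, z.1 < 0 →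
      (1 + dq w z ^ 2) * σ ^ 2 * (2 - Real.exp (β * z.1))
        + 2 * (slope γ lam w z * dq w z) * σ * β * Real.exp (β * z.1)
        - slope γ lam w z ^ 2 * β ^ 2 * Real.exp (β * z.1)
        - driftQ γ lam w z * β * Real.exp (β * z.1)
        + driftP γ lam w z * σ * (2 - Real.exp (β * z.1)) < 0)
    {q p : ℝ} (hq : q ∈ Icc (-L) 0) (hp : p < 0) :
    dq w (q, p) ≤ M * (2 - Real.exp (β * q)) * Real.exp (σ * p) := by
  have hL : 0 ≤ L := by linarith [hq.1, hq.2]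
  set u : ℝ × ℝ → ℝ :=
    fun y => dq w y - M * (2 - Real.exp (β * y.1)) * Real.exp (σ * y.2) with hu
  by_contra! hcon
  have hε : 0 < u (q, p) := sub_pos.2 hcon
  have hexp : ∀ x ≤ (0 : ℝ), Real.exp (β * x) ≤ 1 := fun x hx =>
    Real.exp_le_one_iff.2 (mul_nonpos_of_nonneg_of_nonpos hβ.le hx)
  have hφ : ∀ x ≤ (0 : ℝ), ∀ y : ℝ, 0 ≤ M * (2 - Real.exp (β * x)) * Real.exp (σ * y) :=
    fun x hx y => mul_nonneg (mul_nonneg hM.le (by linarith [hexp x hx])) (Real.exp_pos _).le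
  obtain ⟨P, hP⟩ := hvan _ hε
  set P' := min P p
  have hcompact : IsCompact (Icc (-L) 0 ×ˢ Icc P' 0) := isCompact_Icc.prod isCompact_Icc
  have hmem : (q, p) ∈ Icc (-L) 0 ×ˢ Icc P' 0 := ⟨hq, min_le_right _ _, hp.le⟩
  have hucont : ContinuousOn u (Icc (-L) 0 ×ˢ Icc P' 0) := by
    refine ((continuousOn_dq hw.contDiffOn).mono fun y hy => hy.2.2).sub ?_
    exact Continuous.continuousOn (by fun_prop)
  obtain ⟨z, hzmem, hzmax⟩ := hcompact.exists_isMaxOn ⟨_, hmem⟩ hucont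
  have hzε : u (q, p) ≤ u z := hzmax hmem
  have hzbar : z ∈ Rbar L := ⟨⟨hzmem.1.1, hzmem.1.2.trans hL⟩, hzmem.2.2⟩
  have hz2 : z.2 < 0 := by
    refine lt_of_le_of_ne hzmem.2.2 fun h => ?_
    have h1 : u z = dq w z - M * (2 - Real.exp (β * z.1)) := by simp [hu, h]
    have h2 := mul_le_mul_of_nonneg_left (hexp z.1 hzmem.1.2) hM.le
    linarith [hedge z hzbar]
  have hzP : P' < z.2 := by
    refine lt_of_le_of_ne hzmem.2.1 fun h => ?_
    have h1 := hP z hzbar (h ▸ min_le_left P p)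
    have h2 : u z ≤ dq w z := sub_le_self _ (hφ z.1 hzmem.1.2 z.2)
    linarith [le_abs_self (dq w z)]
  have hside : dq w z ≠ 0 := fun h => by
    have h2 : u z ≤ dq w z := sub_le_self _ (hφ z.1 hzmem.1.2 z.2)
    linarith
  have hz1 : z.1 < 0 := by
    refine lt_of_le_of_ne hzmem.1.2 fun h => hside ?_
    rw [← hw.dq_zero hz2, ← h]
  have hzL : -L < z.1 := by
    refine lt_of_le_of_ne hzmem.1.1 fun h => hside ?_
    rw [← hw.dq_left hz2, h]
  have hzR : z ∈ R L := ⟨⟨hzL, by linarith⟩, hz2⟩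
  have hlocal : IsLocalMax u z :=
    hzmax.isLocalMax (prod_mem_nhds (Icc_mem_nhds hzL hz1) (Icc_mem_nhds hzP hz2))
  have hcond := barrier_conditions hz2 (fun y hy => contDiffAt_dq (n := 3) (m := 2) hy
    (hw.contDiffOn.contDiffAt (halfPlane_mem_nhds hy)) (by norm_num)) hlocal
  have hgq := (hcond (1, 0)).1
  have hgp := (hcond (0, 1)).1
  -- The principal part is the sum of the second derivatives in these two directions.
  have hpp := (hcond (0, 1)).2
  have hbv := (hcond (slope γ lam w z, -dq w z)).2
  have hlin := linearized_eq hw.contDiffOn hF hzR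
  have hs := mul_neg_of_pos_of_neg (mul_pos hM (Real.exp_pos (σ * z.2))) (hsuper z hzR hz1)
  simp only at hgq hgp hpp hbv
  have key : (0 : ℝ) < 0 := by
    linear_combination hs + hpp + hbv - hlin
      + driftQ γ lam w z * hgq + driftP γ lam w z * hgp
  exact lt_irrefl _ key

/-- The barrier is a strict supersolution. The term `-β² b²` beats the first-order coefficient
`D` because `β b² > β δ² > K M² / 2`; what is left of it absorbs the terms carrying a factor `σ`
by the smallness condition on `σ`. -/
lemma supersolution_ineq {M K β σ e e₀ b v D E δ : ℝ} (hδ : 0 < δ) (hK : 0 < K)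
    (hM : 0 < M) (hv : |v| ≤ M) (hb : δ < b) (hbv : |b * v| ≤ K * M ^ 2)
    (hD : |D| ≤ K * M ^ 2 / 4) (hE : |E| ≤ K * M ^ 2) (hβ2 : 2 ≤ β)
    (hβ : K * M ^ 2 / (2 * δ ^ 2) < β) (hσ : 0 < σ) (he₀ : 0 < e₀) (he : e₀ ≤ e) (he1 : e ≤ 1)
    (hstar : 2 * σ ^ 2 * (1 + M ^ 2) + 4 * β * σ * K * M ^ 2 - 1 / 2 * e₀ * K * M ^ 2 < 0) :
    (1 + v ^ 2) * σ ^ 2 * (2 - e) + 2 * (b * v) * σ * β * e - b ^ 2 * β ^ 2 * e - D * β * e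
      + E * σ * (2 - e) < 0 := by
  have hKM : 0 < K * M ^ 2 := by positivity
  have hβ0 : 0 < β := by linarith
  have hepos : 0 < e := he₀.trans_le he
  have hv2 : v ^ 2 ≤ M ^ 2 := sq_le_sq' (by linarith [(abs_le.1 hv).1]) (abs_le.1 hv).2
  have hb2 : δ ^ 2 < b ^ 2 := by gcongr
  have h1 : (1 + v ^ 2) * σ ^ 2 * (2 - e) ≤ (1 + M ^ 2) * σ ^ 2 * 2 := by
    gcongr <;> linarith
  have h2 : 2 * (b * v) * σ * β * e ≤ 2 * β * σ * (K * M ^ 2) := by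
    have : (b * v) * e ≤ K * M ^ 2 * 1 :=
      mul_le_mul ((le_abs_self _).trans hbv) he1 hepos.le hKM.le
    have := mul_le_mul_of_nonneg_left this (show 0 ≤ 2 * σ * β by positivity)
    linarith
  have h3 : E * σ * (2 - e) ≤ 2 * β * σ * (K * M ^ 2) := by
    have h4 : E * (2 - e) ≤ K * M ^ 2 * 2 :=
      mul_le_mul ((le_abs_self _).trans hE) (by linarith) (by linarith) hKM.le
    have h5 : E * (2 - e) ≤ K * M ^ 2 * (2 * β) := h4.trans (by gcongr; linarith)
    have := mul_le_mul_of_nonneg_left h5 hσ.le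
    linarith
  have h6 : K * M ^ 2 / 4 ≤ b ^ 2 * β + D := by
    have h7 : K * M ^ 2 < β * (2 * δ ^ 2) := (div_lt_iff₀ (by positivity)).1 hβ
    have h8 : δ ^ 2 * β ≤ b ^ 2 * β := by gcongr
    linarith [(abs_le.1 hD).1]
  have h9 : 1 / 2 * e₀ * K * M ^ 2 ≤ b ^ 2 * β ^ 2 * e + D * β * e := by
    have h10 : 2 * e₀ ≤ β * e := mul_le_mul hβ2 he he₀.le hβ0.le
    have := mul_le_mul h10 h6 (by positivity) (by positivity)
    linarith
  linarith

/-- A constant for which `supersolution_ineq` applies; `G` bounds `|γ|` and `c` bounds `a⁻¹`.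
The summand `16` ensures `2 ≤ β`. -/
noncomputable def decayConst (G c δ : ℝ) : ℝ :=
  16 + 8 * (1 + c / δ) + 8 * (G * c ^ 3 / δ) + 3 * G * (1 + c / δ) ^ 2

/-- The lower bound `δ ≤ M` makes every coefficient, whatever its degree in `M`, at most a multiple
of `M²`. -/
lemma coeff_bounds {γ : ℝ → ℝ} {lam M δ c G : ℝ} {w : ℝ × ℝ → ℝ} {z : ℝ × ℝ} (hδ : 0 < δ)
    (hδM : δ ≤ M) (ha0 : 0 ≤ (a γ lam z.2)⁻¹) (hac : (a γ lam z.2)⁻¹ ≤ c) (hγ : |γ (-z.2)| ≤ G)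
    (hq : |dq w z| ≤ M) (hp : |dp w z| ≤ M) (hqq : |dq (dq w) z| ≤ M) (hpq : |dp (dq w) z| ≤ M)
    (hpp : |dp (dp w) z| ≤ M) :
    |slope γ lam w z * dq w z| ≤ decayConst G c δ * M ^ 2 ∧
    |driftQ γ lam w z| ≤ decayConst G c δ * M ^ 2 / 4 ∧
    |driftP γ lam w z| ≤ decayConst G c δ * M ^ 2 := by
  have hM : 0 < M := hδ.trans_le hδM
  have hc : 0 ≤ c := ha0.trans hac
  have hG : 0 ≤ G := (abs_nonneg _).trans hγ
  have hcM : c ≤ c / δ * M := by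
    rw [div_mul_eq_mul_div, le_div_iff₀ hδ]
    exact mul_le_mul_of_nonneg_left hδM hc
  have hb : |slope γ lam w z| ≤ (1 + c / δ) * M := by
    refine (abs_add_le _ _).trans ?_
    rw [abs_of_nonneg ha0]
    linarith
  have hx : 0 ≤ (1 + c / δ) := by positivity
  have hbx : ∀ y : ℝ, |y| ≤ M → |slope γ lam w z * y| ≤ (1 + c / δ) * M ^ 2 := fun y hy => by
    rw [abs_mul]
    calc _ ≤ (1 + c / δ) * M * M := mul_le_mul hb hy (abs_nonneg _) (by positivity)
      _ = _ := by ring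
  have hvx : ∀ y : ℝ, |y| ≤ M → |dq w z * y| ≤ M ^ 2 := fun y hy => by
    rw [abs_mul, sq]
    exact mul_le_mul hq hy (abs_nonneg _) hM.le
  have hγa : |γ (-z.2) * (a γ lam z.2)⁻¹ ^ 3 * dq w z| ≤ G * c ^ 3 / δ * M ^ 2 := by
    rw [abs_mul, abs_mul, abs_of_nonneg (pow_nonneg ha0 3)]
    calc _ ≤ G * c ^ 3 * M := by gcongr
      _ = G * c ^ 3 / δ * (δ * M) := by field_simp
      _ ≤ G * c ^ 3 / δ * (M * M) := by gcongr
      _ = _ := by ring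
  have hγb : |γ (-z.2) * slope γ lam w z ^ 2| ≤ G * (1 + c / δ) ^ 2 * M ^ 2 := by
    rw [abs_mul, abs_pow, mul_assoc, ← mul_pow]
    gcongr
  have t0 : 0 ≤ M ^ 2 := by positivity
  have t1 : 0 ≤ (1 + c / δ) * M ^ 2 := by positivity
  have t2 : 0 ≤ G * c ^ 3 / δ * M ^ 2 := by positivity
  have t3 : 0 ≤ G * (1 + c / δ) ^ 2 * M ^ 2 := by positivity
  have hK : decayConst G c δ * M ^ 2 = 16 * M ^ 2 + 8 * ((1 + c / δ) * M ^ 2)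
      + 8 * (G * c ^ 3 / δ * M ^ 2) + 3 * (G * (1 + c / δ) ^ 2 * M ^ 2) := by
    rw [decayConst]; ring
  have b1 := abs_le.1 (hvx _ hpp)
  have b2 := abs_le.1 (hbx _ hpq)
  have b3 := abs_le.1 hγa
  have b4 := abs_le.1 (hvx _ hpq)
  have b5 := abs_le.1 (hbx _ hqq)
  have b6 := abs_le.1 hγb
  rw [hK]
  refine ⟨(hbx _ hq).trans (by linarith), ?_, ?_⟩
  · rw [driftQ, abs_le]
    constructor <;> linarith
  · rw [driftP, abs_le]
    constructor <;> linarith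

/-! ### The decay estimate -/

lemma exists_sigma {M β K L : ℝ} (hM : 0 < M) (hK : 0 < K) :
    ∃ σ₀ : ℝ, 0 < σ₀ ∧ ∀ σ : ℝ, 0 < σ → σ < σ₀ →
      2 * σ ^ 2 * (1 + M ^ 2) + 4 * β * σ * K * M ^ 2
        - 1 / 2 * Real.exp (-β * L) * K * M ^ 2 < 0 := by
  have hcont : Continuous fun σ : ℝ => 2 * σ ^ 2 * (1 + M ^ 2) + 4 * β * σ * K * M ^ 2
      - 1 / 2 * Real.exp (-β * L) * K * M ^ 2 := by fun_prop
  have h0 : 0 < Real.exp (-β * L) * K * M ^ 2 := by positivity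
  obtain ⟨ε, hε, hball⟩ := Metric.eventually_nhds_iff.1
    ((hcont.tendsto 0).eventually_lt_const (u := 0) (by norm_num; positivity))
  refine ⟨ε, hε, fun σ hσ hσε => hball ?_⟩
  rwa [Real.dist_eq, sub_zero, abs_of_pos hσ]

/-- The estimate at the solutions with the nodal properties, for the larger of the two function
spaces. The bound `δ < λ ≤ M`, not required of the trivial
solution, is what forces `2 ≤ β`. -/
lemma abs_dq_le_of_solution {α L g δ lam M β σ G : ℝ} {γ : ℝ → ℝ} {w : ℝ × ℝ → ℝ}
    (hδ : 0 < δ) (hbdd : BddBelow (Gam γ '' Iic 0))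
    (hG : ∀ r ∈ Ici (0 : ℝ), |γ r| ≤ G)
    (hβ : decayConst G (Real.sqrt δ)⁻¹ δ * M ^ 2 / (2 * δ ^ 2) < β) (hσ : 0 < σ)
    (hstar : 2 * σ ^ 2 * (1 + M ^ 2) + 4 * β * σ * decayConst G (Real.sqrt δ)⁻¹ δ * M ^ 2
      - 1 / 2 * Real.exp (-β * L) * decayConst G (Real.sqrt δ)⁻¹ δ * M ^ 2 < 0)
    (hO : (lam, w) ∈ O (Xgrad α L) γ L g δ) (hsol : IsSolution γ L g lam w) (hN : Nodal L w)
    (hnorm : |lam| + normX α L w < M) {q p : ℝ} (hqp : (q, p) ∈ R L) :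
    |dq w (q, p)| ≤ M * (2 - Real.exp (-β * |q|)) * Real.exp (σ * p) := by
  obtain ⟨⟨hw, hvan⟩, hlam, hslope, -⟩ := hO
  simp only at hw hvan hlam hslope
  have hG0 : 0 ≤ G := (abs_nonneg _).trans (hG 0 self_mem_Ici)
  have hδM : δ ≤ M := by
    have h1 := GamInf_nonpos hbdd
    have h2 : 0 ≤ normX α L w := ENNReal.toReal_nonneg
    linarith [le_abs_self lam]
  have hM : 0 < M := hδ.trans_le hδM
  set c := (Real.sqrt δ)⁻¹
  have hc : 0 ≤ c := inv_nonneg.2 (Real.sqrt_nonneg δ)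
  set K := decayConst G c δ with hK
  have hK16 : 16 ≤ K := by
    have h1 : 0 ≤ 8 * (1 + c / δ) := by positivity
    have h2 : 0 ≤ 8 * (G * c ^ 3 / δ) := by positivity
    have h3 : 0 ≤ 3 * G * (1 + c / δ) ^ 2 := by positivity
    rw [hK, decayConst]
    linarith
  have hβ2 : 2 ≤ β := by
    have h1 := (div_lt_iff₀ (by positivity : (0 : ℝ) < 2 * δ ^ 2)).1 hβ
    have h2 : 16 * δ ^ 2 ≤ K * M ^ 2 := by gcongr
    have h3 : 0 < δ ^ 2 := by positivity
    by_contra! h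
    have := mul_lt_mul_of_pos_right h h3
    linarith
  have hpd : ∀ k₁ k₂ : ℕ, k₁ + k₂ ≤ 3 → ∀ z ∈ Rbar L, |pd k₁ k₂ w z| ≤ M :=
    fun k₁ k₂ hk z hz => (abs_pd_le_normX hw hk hz).trans (by linarith [abs_nonneg lam])
  have hRbar : R L ⊆ Rbar L := prod_mono Ioo_subset_Icc_self Iio_subset_Iic_self
  -- The comparison takes place on the left half of `R`; the right half follows by symmetry.
  have hleft : ∀ x ∈ Ioo (-L) 0, |dq w (x, p)| ≤
      M * (2 - Real.exp (β * x)) * Real.exp (σ * p) := by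
    intro x hx
    rw [abs_of_pos (hN.dq_pos x hx p hqp.2.le)]
    refine dq_le_barrier hw hsol.1 (hvan 1 0 le_rfl (by norm_num)) hM (by linarith)
      (fun z hz => (le_abs_self _).trans (hpd 1 0 (by norm_num) z hz)) (fun z hz hz1 => ?_)
      (Ioo_subset_Icc_self hx) hqp.2
    have hzb := hRbar hz
    have ha := a_inv_bounds hδ hbdd hlam hzb.2
    have hcoef := coeff_bounds hδ hδM ha.1 ha.2 (hG (-z.2) (mem_Ici.2 (neg_nonneg.2 hzb.2)))
      (hpd 1 0 (by norm_num) z hzb) (hpd 0 1 (by norm_num) z hzb) (hpd 2 0 (by norm_num) z hzb)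
      (hpd 1 1 (by norm_num) z hzb) (hpd 0 2 (by norm_num) z hzb)
    have hβ0 : 0 ≤ β := by linarith
    refine supersolution_ineq hδ (by linarith) hM (hpd 1 0 (by norm_num) z hzb) (hslope z hz)
      hcoef.1 hcoef.2.1 hcoef.2.2 hβ2 hβ hσ (Real.exp_pos (-β * L)) ?_ ?_ hstar
    · have := mul_le_mul_of_nonneg_left hz.1.1.le hβ0
      exact Real.exp_le_exp.2 (by linarith)
    · exact Real.exp_le_one_iff.2 (mul_nonpos_of_nonneg_of_nonpos hβ0 hz1.le)
  rcases lt_trichotomy q 0 with hq | rfl | hq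
  · have := hleft q ⟨hqp.1.1, hq⟩
    rwa [abs_of_neg hq, neg_mul_neg]
  · rw [hw.dq_zero hqp.2]
    simp only [abs_zero, mul_zero, Real.exp_zero]
    positivity
  · have hqL : q < L := hqp.1.2
    have := hleft (-q) ⟨by linarith, by linarith⟩
    rw [abs_of_pos hq]
    rwa [hw.dq_neg hqp.2, abs_neg, mul_neg, ← neg_mul] at this

lemma dq_eq_zero_of_forall_eq_zero {w : ℝ × ℝ → ℝ} (hw : ∀ z ∈ halfPlane, w z = 0) {z : ℝ × ℝ}
    (hz : z ∈ halfPlane) : dq w z = 0 := by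
  rw [dq, fderivWithin_congr (f := fun _ => (0 : ℝ)) hw (hw z hz)]
  simp

end DeepStokes

theorem mainTheorem5 (α ρ L g δ : ℝ) (hα : α ∈ Ioo (0 : ℝ) 1) (hρ : 0 < ρ) (hL : 0 < L)
    (hg : 0 < g) (hδ : 0 < δ) (γ : ℝ → ℝ) (hγ : DeepStokes.VorticityHolder α γ)
    (hdecay : γ =O[atTop] fun r : ℝ => r ^ (-2 - 2 * ρ)) :
    ∃ K : ℝ, 0 < K ∧ ∀ M : ℝ, 0 < M → ∀ β : ℝ, K * M ^ 2 / (2 * δ ^ 2) < β →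
      (∃ σ₀ : ℝ, 0 < σ₀ ∧ ∀ σ : ℝ, 0 < σ → σ < σ₀ →
        2 * σ ^ 2 * (1 + M ^ 2) + 4 * β * σ * K * M ^ 2
          - 1 / 2 * Real.exp (-β * L) * K * M ^ 2 < 0) ∧
      ∀ σ : ℝ, 0 < σ →
        2 * σ ^ 2 * (1 + M ^ 2) + 4 * β * σ * K * M ^ 2
          - 1 / 2 * Real.exp (-β * L) * K * M ^ 2 < 0 →
        ∀ (lam : ℝ) (w : ℝ × ℝ → ℝ), (lam, w) ∈ DeepStokes.S (DeepStokes.X α L) γ ρ L g δ ∪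
              DeepStokes.S (DeepStokes.Xgrad α L) γ ρ L g δ →
          |lam| + DeepStokes.normX α L w < M →
          ∀ q p : ℝ, (q, p) ∈ DeepStokes.R L →
            |DeepStokes.dq w (q, p)|
              ≤ M * (2 - Real.exp (-β * |q|)) * Real.exp (σ * p) := by
  have hbdd := DeepStokes.bddBelow_Gam (hγ.integrableOn hρ hdecay)
  obtain ⟨-, G, hGb, -⟩ := hγ
  have hG : ∀ r ∈ Ici (0 : ℝ), |γ r| ≤ G := fun r hr => (hGb r hr).1
  have hG0 : 0 ≤ G := (abs_nonneg _).trans (hG 0 self_mem_Ici)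
  have hK : 0 < DeepStokes.decayConst G (Real.sqrt δ)⁻¹ δ := by
    rw [DeepStokes.decayConst]
    positivity
  refine ⟨_, hK, fun M hM β hβ => ⟨DeepStokes.exists_sigma hM hK, ?_⟩⟩
  intro σ hσ hstar lam w hS hnorm q p hqp
  have hβ0 : 0 ≤ β := le_trans (by positivity) hβ.le
  have htrivial : (∀ z ∈ DeepStokes.halfPlane, w z = 0) →
      |DeepStokes.dq w (q, p)| ≤ M * (2 - Real.exp (-β * |q|)) * Real.exp (σ * p) := fun h => by
    rw [DeepStokes.dq_eq_zero_of_forall_eq_zero h (le_of_lt (show p < 0 from hqp.2)), abs_zero]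
    have : Real.exp (-β * |q|) ≤ 1 := Real.exp_le_one_iff.2
      (mul_nonpos_of_nonpos_of_nonneg (by linarith) (abs_nonneg q))
    exact mul_nonneg (mul_nonneg hM.le (by linarith)) (Real.exp_pos _).le
  rcases hS with (⟨hO, hsol, -, hN, -⟩ | ⟨-, h⟩) | (⟨hO, hsol, -, hN, -⟩ | ⟨-, h⟩)
  · exact DeepStokes.abs_dq_le_of_solution hδ hbdd hG hβ hσ hstar
      ⟨⟨hO.1.1, fun k₁ k₂ _ hk => hO.1.2 k₁ k₂ hk⟩, hO.2⟩ hsol hN hnorm hqp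
  · exact htrivial h
  · exact DeepStokes.abs_dq_le_of_solution hδ hbdd hG hβ hσ hstar hO hsol hN hnorm hqp
  · exact htrivial h
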